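/- Let $(X,\rho)$ be a compact metric space and $T\colon X\to X$ a continuous map. For $x,y\in X$ put $$D_B(x,y)=\limsup_{N\to\infty}\frac1N\sum_{n=0}^{N-1}\rho(T^n(x),T^n(y)),$$ the Besicovitch pseudometric on $X$. A point $x\in X$ is called generic for a Borel probability measure $\mu$ on $X$ if the empirical measures $\frac1n\sum_{j=0}^{n-1}\delta_{T^j(x)}$ converge to $\mu$ in the weak$^*$ topology, that is, if $\frac1n\sum_{j=0}^{n-1}f(T^j(x))\to\int_X f\,d\mu$ for every continuous $f\colon X\to\mathbb R$. A measure is called ergodic if it is a $T$-invariant Borel probability measure that gives measure $0$ or $1$ to every Borel set $B$ with $T^{-1}(B)=B$. Let $(\mu_p)_{p\ge1}$ be a sequence of ergodic measures and $(x_p)_{p\ge1}$ a sequence of points of $X$ such that $x_p$ is generic for $\mu_p$ for every $p$. If $x\in X$ satisfies $D_B(x_p,x)\to0$ as $p\to\infty$, then $x$ is generic for some ergodic measure. Consequently, the set of all points of $X$ that are generic for some ergodic measure is closed in the topology induced on $X$ by the pseudometric $D_B$. -/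

import Mathlib

open Filter Topology MeasureTheory

namespace TopDyn

/-- The average `(1/N) ∑_{n<N} ρ(u n, v n)`. -/
noncomputable def avgDist {X : Type*} [MetricSpace X] (u v : ℕ → X) (N : ℕ) : ℝ :=
  (1 / (N : ℝ)) * ∑ n ∈ Finset.range N, dist (u n) (v n)

/-- The Besicovitch pseudodistance on sequences,
`limsup_{N → ∞} (1/N) ∑_{n<N} ρ(u n, v n)`. On a compact space the averages are bounded
(see `avgDist_le_diam`), so this real `limsup` is the usual one. -/
noncomputable def besicovitchSeqDist {X : Type*} [MetricSpace X] (u v : ℕ → X) : ℝ :=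
  limsup (avgDist u v) atTop

/-- The Besicovitch pseudodistance `D_B(x, y)` of `(X, T)`: the distance between orbits. -/
noncomputable def besicovitchDist {X : Type*} [MetricSpace X] (T : X → X) (x y : X) : ℝ :=
  besicovitchSeqDist (fun n => T^[n] x) (fun n => T^[n] y)

/-- The point `x` is generic for `μ`: the empirical measures `(1/n) ∑_{j<n} δ_{T^j x}` converge
weak-* to `μ`, that is, the averages `(1/n) ∑_{j<n} f (T^j x)` converge to `∫ f dμ` for every
continuous `f : X → ℝ`. -/
def IsGenericFor {X : Type*} [MetricSpace X] [MeasurableSpace X] [BorelSpace X]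
    (T : X → X) (x : X) (μ : ProbabilityMeasure X) : Prop :=
  ∀ f : C(X, ℝ), Tendsto (fun n : ℕ => (1 / (n : ℝ)) * ∑ j ∈ Finset.range n, f (T^[j] x)) atTop
    (𝓝 (∫ y, f y ∂(μ : Measure X)))

/-- The set of all points that are generic for some ergodic Borel probability measure. -/
def ergodicGenericPoints {X : Type*} [MetricSpace X] [MeasurableSpace X] [BorelSpace X]
    (T : X → X) : Set X :=
  {x | ∃ μ : ProbabilityMeasure X, Ergodic T (μ : Measure X) ∧ IsGenericFor T x μ}

section Pseudometric

theorem avgDist_nonneg {X : Type*} [MetricSpace X] (u v : ℕ → X) (N : ℕ) : 0 ≤ avgDist u v N := by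
  unfold avgDist
  exact mul_nonneg (by positivity) (Finset.sum_nonneg fun _ _ => dist_nonneg)

theorem avgDist_le_diam {X : Type*} [MetricSpace X] [CompactSpace X] (u v : ℕ → X) (N : ℕ) :
    avgDist u v N ≤ Metric.diam (Set.univ : Set X) := by
  unfold avgDist
  have hb : ∑ n ∈ Finset.range N, dist (u n) (v n) ≤ N * Metric.diam (Set.univ : Set X) := by
    have := Finset.sum_le_card_nsmul (Finset.range N) (fun n => dist (u n) (v n))
      (Metric.diam (Set.univ : Set X)) (fun n _ =>
        Metric.dist_le_diam_of_mem isCompact_univ.isBounded (Set.mem_univ _) (Set.mem_univ _))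
    simpa using this
  rcases Nat.eq_zero_or_pos N with rfl | hN
  · simpa using Metric.diam_nonneg
  · have hN' : (0 : ℝ) < N := by exact_mod_cast hN
    rw [one_div, inv_mul_le_iff₀ hN']
    exact hb

theorem avgDist_triangle {X : Type*} [MetricSpace X] (u v w : ℕ → X) (N : ℕ) :
    avgDist u w N ≤ avgDist u v N + avgDist v w N := by
  unfold avgDist
  rw [← mul_add, ← Finset.sum_add_distrib]
  exact mul_le_mul_of_nonneg_left (Finset.sum_le_sum fun n _ => dist_triangle _ _ _)
    (by positivity)

theorem avgDist_isBoundedUnder {X : Type*} [MetricSpace X] [CompactSpace X] (u v : ℕ → X) :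
    IsBoundedUnder (· ≤ ·) atTop (avgDist u v) :=
  isBoundedUnder_of ⟨_, avgDist_le_diam u v⟩

theorem avgDist_isBoundedUnder_ge {X : Type*} [MetricSpace X] (u v : ℕ → X) :
    IsBoundedUnder (· ≥ ·) atTop (avgDist u v) :=
  isBoundedUnder_of ⟨0, avgDist_nonneg u v⟩

theorem besicovitchSeqDist_self {X : Type*} [MetricSpace X] (u : ℕ → X) :
    besicovitchSeqDist u u = 0 := by
  have : avgDist u u = fun _ => 0 := by
    funext N
    simp [avgDist]
  rw [besicovitchSeqDist, this, limsup_const]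

theorem besicovitchSeqDist_comm {X : Type*} [MetricSpace X] (u v : ℕ → X) :
    besicovitchSeqDist u v = besicovitchSeqDist v u := by
  have : avgDist u v = avgDist v u := by
    funext N
    simp [avgDist, dist_comm]
  rw [besicovitchSeqDist, besicovitchSeqDist, this]

theorem besicovitchSeqDist_triangle {X : Type*} [MetricSpace X] [CompactSpace X]
    (u v w : ℕ → X) :
    besicovitchSeqDist u w ≤ besicovitchSeqDist u v + besicovitchSeqDist v w := by
  have h1 : besicovitchSeqDist u w ≤ limsup (avgDist u v + avgDist v w) atTop := by
    refine limsup_le_limsup (Eventually.of_forall fun N => avgDist_triangle u v w N)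
      (avgDist_isBoundedUnder_ge u w).isCoboundedUnder_le ?_
    exact isBoundedUnder_of ⟨_, fun N => add_le_add (avgDist_le_diam u v N) (avgDist_le_diam v w N)⟩
  exact h1.trans (limsup_add_le (avgDist_isBoundedUnder_ge u v) (avgDist_isBoundedUnder u v)
    (avgDist_isBoundedUnder_ge v w).isCoboundedUnder_le (avgDist_isBoundedUnder v w))

/-- `D_B` as a pseudometric on `X`, used for the topology it induces. It is not an instance, so
it does not interfere with the original metric. -/
@[reducible] noncomputable def besicovitchPseudoMetric {X : Type*} [MetricSpace X] [CompactSpace X]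
    (T : X → X) : PseudoMetricSpace X where
  dist := besicovitchDist T
  dist_self _ := besicovitchSeqDist_self _
  dist_comm _ _ := besicovitchSeqDist_comm _ _
  dist_triangle _ _ _ := besicovitchSeqDist_triangle _ _ _

/-- The topology on `X` induced by the pseudometric `D_B`. -/
@[reducible] noncomputable def besicovitchTopology {X : Type*} [MetricSpace X] [CompactSpace X]
    (T : X → X) : TopologicalSpace X :=
  (besicovitchPseudoMetric T).toUniformSpace.toTopologicalSpace

end Pseudometric

end TopDyn

/-! Uniform continuity turns smallness of `besicovitchDist` into smallness of the mean of `|f (T^n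
x_p) - f (T^n x)|` for each continuous `f`. Hence time averages along `x` are eventually close to `∫
f dμ_p`, and a weak-* cluster point `ν` of the `μ_p` is a measure for which `x` is generic.
Ergodicity need not survive weak-* limits, so it is tested by a quantity that survives here: an
invariant measure is ergodic iff each continuous `f` has Birkhoff averages `A_k f` arbitrarily close
to constants in `L¹`. The function `|A_k f - c|` is again continuous, so genericity turns its
integrals against `μ_p` and `ν` into time averages along `x_p` and `x`. These differ by little,
uniformly in `k` and `c`. -/

theorem ContinuousMap.exists_dist_le_add_mul_dist {X : Type*} [PseudoMetricSpace X] [CompactSpace X]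
    (f : C(X, ℝ)) {ε : ℝ} (hε : 0 < ε) :
    ∃ C : ℝ, 0 < C ∧ ∀ a b, |f a - f b| ≤ ε + C * dist a b := by
  obtain ⟨δ, hδ, h⟩ := Metric.uniformContinuous_iff.1
    (CompactSpace.uniformContinuous_of_continuous f.continuous) ε hε
  -- At distance at least `δ` the linear term alone exceeds the oscillation `2 * ‖f‖`; the `+ 1`
  -- keeps the constant positive when `f = 0`.
  refine ⟨(2 * ‖f‖ + 1) / δ, by positivity, fun a b => ?_⟩
  rcases lt_or_ge (dist a b) δ with hab | hab
  · have h1 := (h hab).le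
    rw [Real.dist_eq] at h1
    have : 0 ≤ (2 * ‖f‖ + 1) / δ * dist a b := by positivity
    linarith
  · have h1 : |f a - f b| ≤ 2 * ‖f‖ := by
      have := f.dist_le_two_norm a b
      rwa [Real.dist_eq] at this
    have h2 : (2 * ‖f‖ + 1) ≤ (2 * ‖f‖ + 1) / δ * dist a b := by
      rw [div_mul_eq_mul_div, le_div_iff₀ hδ]
      gcongr
    linarith

/-- The average of the first `k` iterates of `f` under composition with `T`. -/
noncomputable def ContinuousMap.ergodicAverage {X : Type*} [TopologicalSpace X] (T : C(X, X))
    (k : ℕ) (f : C(X, ℝ)) : C(X, ℝ) :=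
  birkhoffAverage ℝ (fun g : C(X, ℝ) => g.comp T) id k f

theorem ContinuousMap.iterate_comp_apply {X : Type*} [TopologicalSpace X] (T : C(X, X))
    (n : ℕ) (f : C(X, ℝ)) (x : X) :
    ((fun g : C(X, ℝ) => g.comp T)^[n] f) x = f (T^[n] x) := by
  induction n generalizing f with
  | zero => rfl
  | succ n ih =>
    rw [Function.iterate_succ_apply, ih, Function.iterate_succ_apply', ContinuousMap.comp_apply]

theorem ContinuousMap.ergodicAverage_apply {X : Type*} [TopologicalSpace X] (T : C(X, X))
    (k : ℕ) (f : C(X, ℝ)) (x : X) :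
    ergodicAverage T k f x = (k : ℝ)⁻¹ * ∑ j ∈ Finset.range k, f (T^[j] x) := by
  simp [ergodicAverage, birkhoffAverage, birkhoffSum, iterate_comp_apply]

/-! ### Ergodicity and `L¹` convergence of Birkhoff averages -/

section MeanErgodic

variable {X : Type*} [MetricSpace X] [CompactSpace X] [MeasurableSpace X] [BorelSpace X]

/-- The `L¹` norm is at most the `L²` norm on a probability space. -/
theorem MeasureTheory.Lp.integral_abs_le_norm {α : Type*} [MeasurableSpace α] {μ : Measure α}
    [IsProbabilityMeasure μ] (F : Lp ℝ 2 μ) : ∫ x, |F x| ∂μ ≤ ‖F‖ := by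
  have h1 : ∫ x, |F x| ∂μ = (eLpNorm F 1 μ).toReal := by
    rw [eLpNorm_one_eq_lintegral_enorm, ← integral_norm_eq_lintegral_enorm
      (Lp.aestronglyMeasurable F)]
    simp [Real.norm_eq_abs]
  rw [h1, Lp.norm_def]
  exact ENNReal.toReal_mono (Lp.eLpNorm_ne_top F)
    (eLpNorm_le_eLpNorm_of_exponent_le (by norm_num) (Lp.aestronglyMeasurable F))

/-- The `L¹` form of the mean ergodic theorem for continuous functions. -/
theorem Ergodic.exists_integral_ergodicAverage_sub_const_le {μ : Measure X}
    [IsProbabilityMeasure μ] (T : C(X, X)) (hT : Ergodic T μ) (f : C(X, ℝ)) {ε : ℝ} (hε : 0 < ε) :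
    ∃ k : ℕ, 0 < k ∧ ∃ c : ℝ, ∫ x, |ContinuousMap.ergodicAverage T k f x - c| ∂μ ≤ ε := by
  let U : Lp ℝ 2 μ →L[ℝ] Lp ℝ 2 μ :=
    (Lp.compMeasurePreservingₗᵢ ℝ T hT.toMeasurePreserving).toContinuousLinearMap
  have hU : ‖U‖ ≤ 1 := LinearIsometry.norm_toContinuousLinearMap_le _
  let ι : C(X, ℝ) →L[ℝ] Lp ℝ 2 μ := ContinuousMap.toLp 2 μ ℝ
  have hι : ∀ g : C(X, ℝ), U (ι g) = ι (g.comp T) := by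
    intro g
    apply Lp.ext
    have h1 := Lp.coeFn_compMeasurePreserving (ι g) hT.toMeasurePreserving
    have h2 := hT.quasiMeasurePreserving.ae_eq_comp (ContinuousMap.coeFn_toLp (p := 2) (𝕜 := ℝ) μ g)
    exact h1.trans (h2.trans (ContinuousMap.coeFn_toLp (p := 2) (𝕜 := ℝ) μ (g.comp T)).symm)
  have hiter : ∀ n : ℕ, U^[n] (ι f) = ι ((fun g : C(X, ℝ) => g.comp T)^[n] f) := by
    intro n
    induction n with
    | zero => rfl
    | succ n ih => rw [Function.iterate_succ_apply', ih, hι, Function.iterate_succ_apply']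
  have havg : ∀ k, birkhoffAverage ℝ U id k (ι f) = ι (ContinuousMap.ergodicAverage T k f) := by
    intro k
    simp [ContinuousMap.ergodicAverage, birkhoffAverage, birkhoffSum, hiter]
  -- Von Neumann: the averages converge in `L²` to the projection onto the `U`-fixed vectors, which
  -- ergodicity makes constant.
  have hlim := U.tendsto_birkhoffAverage_orthogonalProjection hU (ι f)
  set P := (U.eqLocus (1 : Lp ℝ 2 μ →L[ℝ] Lp ℝ 2 μ)).orthogonalProjectionOnto (ι f)
  have hP : U (P : Lp ℝ 2 μ) = P := P.2
  have hPc : (P : Lp ℝ 2 μ) ∘ T =ᵐ[μ] (P : Lp ℝ 2 μ) := by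
    have h1 := Lp.coeFn_compMeasurePreserving (P : Lp ℝ 2 μ) hT.toMeasurePreserving
    have h2 : Lp.compMeasurePreserving T hT.toMeasurePreserving (P : Lp ℝ 2 μ) = P := hP
    rw [h2] at h1
    exact h1.symm
  obtain ⟨c, hc⟩ := hT.ae_eq_const_of_ae_eq_comp_ae (Lp.aestronglyMeasurable _) hPc
  obtain ⟨k, hk, hk0⟩ := ((Metric.tendsto_nhds.1 hlim ε hε).and (eventually_gt_atTop 0)).exists
  refine ⟨k, hk0, c, ?_⟩
  rw [havg, dist_eq_norm] at hk
  refine le_trans (le_of_eq ?_) ((Lp.integral_abs_le_norm _).trans hk.le)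
  refine integral_congr_ae ?_
  filter_upwards [hc, Lp.coeFn_sub (ι (ContinuousMap.ergodicAverage T k f)) (P : Lp ℝ 2 μ),
    ContinuousMap.coeFn_toLp (p := 2) (𝕜 := ℝ) μ (ContinuousMap.ergodicAverage T k f)]
    with y h1 h2 h3
  rw [h2, Pi.sub_apply, h1, h3]
  rfl

/-- An invariant measure is ergodic once the averages of each continuous function come
arbitrarily close to constants in `L¹`. -/
theorem MeasureTheory.MeasurePreserving.ergodic_of_ergodicAverage {μ : Measure X}
    [IsProbabilityMeasure μ] (T : C(X, X)) (hT : MeasurePreserving T μ μ)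
    (h : ∀ (f : C(X, ℝ)) (ε : ℝ), 0 < ε → ∃ k : ℕ, 0 < k ∧ ∃ c : ℝ,
      ∫ x, |ContinuousMap.ergodicAverage T k f x - c| ∂μ ≤ ε) : Ergodic T μ := by
  refine ⟨hT, ⟨fun s hs hinv => ?_⟩⟩
  set φ : X → ℝ := s.indicator (fun _ => 1) with hφ
  have hφi : Integrable φ μ := (integrable_const 1).indicator hs
  have hφT : ∀ n x, φ (T^[n] x) = φ x := by
    intro n x
    have : T^[n] ⁻¹' s = s := by
      rw [Set.preimage_iterate_eq]; exact (Function.IsFixedPt.iterate hinv n)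
    have h2 : (T^[n] x ∈ s) ↔ x ∈ s := by
      conv_rhs => rw [← this]
      rfl
    by_cases hx : x ∈ s
    · simp [hφ, hx, h2.2 hx]
    · simp [hφ, hx, h2]
  -- Approximate `φ` in `L¹` by a continuous `f`. Averaging fixes `φ` and contracts `L¹`, so `A_k f`
  -- is as close to `φ` as `f` is, whatever `k` the hypothesis supplies.
  have hclose : ∀ ε > 0, ∃ c : ℝ, ∫ x, |φ x - c| ∂μ ≤ ε + ε := by
    intro ε hε
    obtain ⟨g, hg, -⟩ := hφi.exists_boundedContinuous_integral_sub_le hε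
    let f : C(X, ℝ) := g.toContinuousMap
    have hfi : Integrable f μ := f.continuous.integrable_of_hasCompactSupport
      (HasCompactSupport.of_compactSpace _)
    obtain ⟨k, hk, c, hc⟩ := h f ε hε
    set A := ContinuousMap.ergodicAverage T k f with hA
    have hAi : Integrable A μ := A.continuous.integrable_of_hasCompactSupport
      (HasCompactSupport.of_compactSpace _)
    have hiter : ∀ j : ℕ, Integrable (fun x => |φ (T^[j] x) - f (T^[j] x)|) μ := fun j =>
      ((hT.iterate j).integrable_comp_of_integrable (hφi.sub hfi).abs)
    have hk' : (0 : ℝ) < k := by exact_mod_cast hk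
    have h1 : ∀ x, |φ x - A x| ≤ (k : ℝ)⁻¹ * ∑ j ∈ Finset.range k, |φ (T^[j] x) - f (T^[j] x)| := by
      intro x
      have : φ x - A x = (k : ℝ)⁻¹ * ∑ j ∈ Finset.range k, (φ (T^[j] x) - f (T^[j] x)) := by
        rw [hA, ContinuousMap.ergodicAverage_apply, Finset.sum_sub_distrib]
        simp only [hφT, Finset.sum_const, Finset.card_range, nsmul_eq_mul]
        field_simp
      rw [this, abs_mul, abs_of_pos (inv_pos.2 hk')]
      gcongr
      exact Finset.abs_sum_le_sum_abs _ _
    have h2 : ∫ x, |φ x - A x| ∂μ ≤ ε := by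
      calc ∫ x, |φ x - A x| ∂μ
          ≤ ∫ x, (k : ℝ)⁻¹ * ∑ j ∈ Finset.range k, |φ (T^[j] x) - f (T^[j] x)| ∂μ :=
            integral_mono (hφi.sub hAi).abs
              ((integrable_finsetSum _ fun j _ => hiter j).const_mul _) h1
        _ = (k : ℝ)⁻¹ * ∑ j ∈ Finset.range k, ∫ x, |φ (T^[j] x) - f (T^[j] x)| ∂μ := by
            rw [integral_const_mul, integral_finsetSum _ fun j _ => hiter j]
        _ ≤ (k : ℝ)⁻¹ * ∑ j ∈ Finset.range k, ε := by
            gcongr with j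
            have hj := hT.iterate j
            have := integral_map (μ := μ) hj.aemeasurable (f := fun y => |φ y - f y|)
              (by rw [hj.map_eq]; exact (hφi.sub hfi).abs.aestronglyMeasurable)
            rw [hj.map_eq] at this
            rw [← this]
            exact hg
        _ = ε := by
            simp only [Finset.sum_const, Finset.card_range, nsmul_eq_mul]
            field_simp
    refine ⟨c, ?_⟩
    calc ∫ x, |φ x - c| ∂μ ≤ ∫ x, (|φ x - A x| + |A x - c|) ∂μ :=
          integral_mono (hφi.sub (integrable_const c)).abs
            ((hφi.sub hAi).abs.add (hAi.sub (integrable_const c)).abs) fun x => abs_sub_le _ _ _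
      _ = ∫ x, |φ x - A x| ∂μ + ∫ x, |A x - c| ∂μ :=
          integral_add (hφi.sub hAi).abs (hAi.sub (integrable_const c)).abs
      _ ≤ ε + ε := add_le_add h2 hc
  set b := ∫ x, φ x ∂μ with hb
  have hzero : ∫ x, |φ x - b| ∂μ = 0 := by
    refine le_antisymm (le_of_forall_pos_le_add fun ε hε => ?_)
      (integral_nonneg fun _ => abs_nonneg _)
    obtain ⟨c, hc⟩ := hclose (ε / 4) (by positivity)
    have hci : Integrable (fun x => φ x - c) μ := hφi.sub (integrable_const c)
    -- The mean `b` is no farther from `c` than the `L¹` distance from `φ` to `c`, so one constant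
    -- serves for every `ε`.
    have h1 : |c - b| ≤ ε / 4 + ε / 4 := by
      have : ∫ x, (φ x - c) ∂μ = b - c := by
        rw [integral_sub hφi (integrable_const c)]
        simp [hb]
      rw [abs_sub_comm, ← this]
      exact (abs_integral_le_integral_abs).trans hc
    calc ∫ x, |φ x - b| ∂μ ≤ ∫ x, (|φ x - c| + |c - b|) ∂μ :=
          integral_mono (hφi.sub (integrable_const b)).abs
            (hci.abs.add (integrable_const _)) fun x => abs_sub_le _ _ _
      _ = ∫ x, |φ x - c| ∂μ + |c - b| := by
          rw [integral_add hci.abs (integrable_const _)]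
          simp
      _ ≤ 0 + ε := by linarith
  have hae : ∀ᵐ x ∂μ, φ x = b := by
    have := (integral_eq_zero_iff_of_nonneg (fun x => abs_nonneg _)
      (hφi.sub (integrable_const b)).abs).1 hzero
    filter_upwards [this] with x hx
    exact sub_eq_zero.1 (abs_eq_zero.1 hx)
  rw [Filter.eventuallyConst_set]
  by_cases hb1 : b = 1
  · left
    filter_upwards [hae] with x hx
    by_contra hxs
    have : φ x = 0 := Set.indicator_of_notMem hxs _
    rw [this, hb1] at hx
    exact zero_ne_one hx
  · right
    filter_upwards [hae] with x hx
    have : x ∉ s := fun hxs => hb1 (hx ▸ Set.indicator_of_mem hxs _)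
    simpa using this

end MeanErgodic

/-! ### Passing genericity and ergodicity to a Besicovitch limit -/

namespace TopDyn

variable {X : Type*} [MetricSpace X] [CompactSpace X]

theorem besicovitchDist_eventually_avg_le (T : X → X) {xs : ℕ → X} {x : X}
    (h : Tendsto (fun p => besicovitchDist T (xs p) x) atTop (𝓝 0)) (f : C(X, ℝ))
    {ε : ℝ} (hε : 0 < ε) : ∀ᶠ p in atTop, ∀ᶠ N : ℕ in atTop,
      (1 / (N : ℝ)) * ∑ n ∈ Finset.range N, |f (T^[n] (xs p)) - f (T^[n] x)| ≤ ε := by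
  obtain ⟨C, hC, hf⟩ := f.exists_dist_le_add_mul_dist (half_pos hε)
  filter_upwards [h.eventually_lt_const (show 0 < ε / 2 / C by positivity)] with p hp
  have h1 := eventually_lt_of_limsup_lt hp (avgDist_isBoundedUnder _ _)
  filter_upwards [h1, eventually_gt_atTop 0] with N hN hN0
  have hN' : (0 : ℝ) < N := by exact_mod_cast hN0
  calc (1 / (N : ℝ)) * ∑ n ∈ Finset.range N, |f (T^[n] (xs p)) - f (T^[n] x)|
      ≤ (1 / (N : ℝ)) * ∑ n ∈ Finset.range N, (ε / 2 + C * dist (T^[n] (xs p)) (T^[n] x)) := by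
        gcongr
        exact hf _ _
    _ = ε / 2 + C * avgDist (fun n => T^[n] (xs p)) (fun n => T^[n] x) N := by
        rw [avgDist, Finset.sum_add_distrib, ← Finset.mul_sum]
        simp only [Finset.sum_const, Finset.card_range, nsmul_eq_mul]
        field_simp
    _ ≤ ε / 2 + C * (ε / 2 / C) := by gcongr
    _ = ε := by field_simp; ring

variable [MeasurableSpace X] [BorelSpace X]

/-- The time averages of `f` and `f ∘ T` along an orbit differ only by two end terms divided by `n`.
-/
theorem IsGenericFor.measurePreserving (T : C(X, X)) {x : X} {μ : ProbabilityMeasure X}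
    (h : IsGenericFor T x μ) : MeasurePreserving T (μ : Measure X) (μ : Measure X) := by
  refine ⟨T.continuous.measurable, ?_⟩
  have : IsFiniteMeasure ((μ : Measure X).map T) := inferInstance
  refine ext_of_forall_integral_eq_of_IsFiniteMeasure fun g => ?_
  rw [integral_map T.continuous.measurable.aemeasurable
    g.continuous.measurable.aestronglyMeasurable]
  let f : C(X, ℝ) := g.toContinuousMap
  have h1 := h (f.comp T)
  have h2 := h f
  refine tendsto_nhds_unique h1 ?_
  have hdiff := tendsto_birkhoffAverage_apply_sub_birkhoffAverage' ℝ (g := f) (f := T)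
    (isCompact_range f.continuous).isBounded x
  have h3 := hdiff.add h2
  rw [zero_add] at h3
  refine h3.congr fun n => ?_
  simp only [birkhoffAverage, birkhoffSum, smul_eq_mul, one_div, sub_add_cancel,
    ContinuousMap.comp_apply, ← Function.iterate_succ_apply, Function.iterate_succ_apply']

/-- The space of probability measures is compact, so the `μ p` have a cluster point. A single `p`,
good for both `f` and `ε`, controls all large `N`, so no subsequence is needed. -/
theorem exists_isGenericFor_of_tendsto (T : X → X) {μ : ℕ → ProbabilityMeasure X} {xs : ℕ → X}
    {x : X} (hgen : ∀ p, IsGenericFor T (xs p) (μ p))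
    (h : Tendsto (fun p => besicovitchDist T (xs p) x) atTop (𝓝 0)) :
    ∃ ν : ProbabilityMeasure X, IsGenericFor T x ν := by
  obtain ⟨ν, hν⟩ := exists_clusterPt_of_compactSpace (map μ atTop)
  refine ⟨ν, fun f => ?_⟩
  rw [Metric.tendsto_nhds]
  intro ε hε
  have hcont : Continuous fun m : ProbabilityMeasure X => ∫ y, f y ∂(m : Measure X) :=
    ProbabilityMeasure.continuous_integral_boundedContinuousFunction
      (BoundedContinuousFunction.mkOfCompact f)
  have hfreq : ∃ᶠ p in atTop,
      dist (∫ y, f y ∂(μ p : Measure X)) (∫ y, f y ∂(ν : Measure X)) < ε / 4 :=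
    MapClusterPt.frequently hν
      (hcont.continuousAt.eventually (Metric.ball_mem_nhds _ (by positivity)))
  obtain ⟨p, hp1, hp2⟩ := (hfreq.and_eventually
    (besicovitchDist_eventually_avg_le T h f (show 0 < ε / 4 by positivity))).exists
  filter_upwards [hp2, Metric.tendsto_nhds.1 (hgen p f) (ε / 4) (by positivity)] with N h1 h2
  have h3 : |(1 / (N : ℝ)) * ∑ j ∈ Finset.range N, f (T^[j] (xs p)) -
      (1 / (N : ℝ)) * ∑ j ∈ Finset.range N, f (T^[j] x)| ≤ ε / 4 := by
    rw [← mul_sub, ← Finset.sum_sub_distrib, abs_mul, abs_of_nonneg (by positivity)]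
    exact (mul_le_mul_of_nonneg_left (Finset.abs_sum_le_sum_abs _ _) (by positivity)).trans h1
  rw [Real.dist_eq] at hp1 h2 ⊢
  rw [abs_lt] at *
  rw [abs_le] at h3
  constructor <;> linarith

/-- Averaging a bounded sequence over a sliding window does not increase its mean
asymptotically. -/
theorem eventually_avg_window_le {a : ℕ → ℝ} {M : ℝ} (ha : ∀ n, 0 ≤ a n) (haM : ∀ n, a n ≤ M)
    (k : ℕ) {ε : ℝ} (hε : 0 < ε)
    (h : ∀ᶠ N : ℕ in atTop, (1 / (N : ℝ)) * ∑ n ∈ Finset.range N, a n ≤ ε) :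
    ∀ᶠ N : ℕ in atTop, (1 / (N : ℝ)) * ∑ n ∈ Finset.range N,
      ((k : ℝ)⁻¹ * ∑ j ∈ Finset.range k, a (j + n)) ≤ 2 * ε := by
  have hM : 0 ≤ M := (ha 0).trans (haM 0)
  have hlim : Tendsto (fun N : ℕ => k * M / (N : ℝ)) atTop (𝓝 0) :=
    tendsto_const_div_atTop_nhds_zero_nat _
  filter_upwards [h, hlim.eventually_le_const hε] with N h1 h2
  -- A shifted window overhangs `N` by fewer than `k` terms, an error that vanishes after division
  -- by `N`.
  have hshift : ∀ j ∈ Finset.range k, ∑ n ∈ Finset.range N, a (j + n) ≤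
      ∑ n ∈ Finset.range N, a n + k * M := by
    intro j hj
    have e1 := Finset.sum_range_add a j N
    have e2 := Finset.sum_range_add a N j
    have e3 : ∑ i ∈ Finset.range j, a (N + i) ≤ k * M := by
      calc ∑ i ∈ Finset.range j, a (N + i) ≤ ∑ i ∈ Finset.range j, M :=
            Finset.sum_le_sum fun i _ => haM _
        _ = j * M := by simp
        _ ≤ k * M := by
            gcongr
            exact (Finset.mem_range.1 hj).le
    have e4 : 0 ≤ ∑ i ∈ Finset.range j, a i := Finset.sum_nonneg fun i _ => ha i
    rw [add_comm N j] at e2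
    linarith
  have hS : 0 ≤ ∑ n ∈ Finset.range N, a n := Finset.sum_nonneg fun i _ => ha i
  calc (1 / (N : ℝ)) * ∑ n ∈ Finset.range N, ((k : ℝ)⁻¹ * ∑ j ∈ Finset.range k, a (j + n))
      = (1 / (N : ℝ)) * ((k : ℝ)⁻¹ * ∑ j ∈ Finset.range k, ∑ n ∈ Finset.range N, a (j + n)) := by
        rw [← Finset.mul_sum, Finset.sum_comm]
    _ ≤ (1 / (N : ℝ)) * ((k : ℝ)⁻¹ * ∑ j ∈ Finset.range k,
          (∑ n ∈ Finset.range N, a n + k * M)) := by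
        gcongr with j hj
        exact hshift j hj
    _ = (1 / (N : ℝ)) * (((k : ℝ)⁻¹ * k) * (∑ n ∈ Finset.range N, a n + k * M)) := by
        simp only [Finset.sum_const, Finset.card_range, nsmul_eq_mul, mul_assoc]
    -- An inequality, since `k = 0` is allowed and then `k⁻¹ * k = 0`.
    _ ≤ (1 / (N : ℝ)) * (1 * (∑ n ∈ Finset.range N, a n + k * M)) := by
        gcongr
        exact inv_mul_le_one
    _ = (1 / (N : ℝ)) * ∑ n ∈ Finset.range N, a n + k * M / N := by ring
    _ ≤ 2 * ε := by linarith

/-- The error does not depend on `k` or `c`, so these may be chosen after the point `y`. -/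
theorem IsGenericFor.integral_abs_ergodicAverage_sub_le (T : C(X, X)) {x y : X}
    {μ ν : ProbabilityMeasure X} (hx : IsGenericFor T x ν) (hy : IsGenericFor T y μ)
    (f : C(X, ℝ)) {ε : ℝ} (hε : 0 < ε) (h : ∀ᶠ N : ℕ in atTop,
      (1 / (N : ℝ)) * ∑ n ∈ Finset.range N, |f (T^[n] y) - f (T^[n] x)| ≤ ε) (k : ℕ) (c : ℝ) :
    ∫ z, |ContinuousMap.ergodicAverage T k f z - c| ∂(ν : Measure X) ≤
      ∫ z, |ContinuousMap.ergodicAverage T k f z - c| ∂(μ : Measure X) + 2 * ε := by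
  let g : C(X, ℝ) := ⟨fun z => |ContinuousMap.ergodicAverage T k f z - c|, by fun_prop⟩
  refine le_of_tendsto_of_tendsto (hx g) ((hy g).add_const _) ?_
  have hb : ∀ n, |f (T^[n] y) - f (T^[n] x)| ≤ 2 * ‖f‖ := fun n => by
    rw [← Real.dist_eq]
    exact f.dist_le_two_norm _ _
  filter_upwards [eventually_avg_window_le (fun n => abs_nonneg _) hb k hε h] with N hN
  refine le_trans ?_ (add_le_add_right hN _)
  rw [← mul_add, ← Finset.sum_add_distrib]
  refine mul_le_mul_of_nonneg_left (Finset.sum_le_sum fun n _ => ?_) (by positivity)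
  have h1 : |ContinuousMap.ergodicAverage T k f (T^[n] x) -
      ContinuousMap.ergodicAverage T k f (T^[n] y)| ≤
      (k : ℝ)⁻¹ * ∑ j ∈ Finset.range k, |f (T^[j + n] y) - f (T^[j + n] x)| := by
    rw [ContinuousMap.ergodicAverage_apply, ContinuousMap.ergodicAverage_apply, abs_sub_comm,
      ← mul_sub, ← Finset.sum_sub_distrib, abs_mul, abs_of_nonneg (by positivity)]
    refine mul_le_mul_of_nonneg_left ?_ (by positivity)
    simp only [Function.iterate_add_apply]
    exact Finset.abs_sum_le_sum_abs _ _
  have h2 := abs_sub_le (ContinuousMap.ergodicAverage T k f (T^[n] x))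
    (ContinuousMap.ergodicAverage T k f (T^[n] y)) c
  change |ContinuousMap.ergodicAverage T k f (T^[n] x) - c| ≤
    |ContinuousMap.ergodicAverage T k f (T^[n] y) - c| + _
  linarith

theorem exists_ergodic_isGenericFor_of_tendsto (T : C(X, X)) {μ : ℕ → ProbabilityMeasure X}
    {xs : ℕ → X} {x : X} (herg : ∀ p, Ergodic T (μ p : Measure X))
    (hgen : ∀ p, IsGenericFor T (xs p) (μ p))
    (h : Tendsto (fun p => besicovitchDist T (xs p) x) atTop (𝓝 0)) :
    ∃ ν : ProbabilityMeasure X, Ergodic T (ν : Measure X) ∧ IsGenericFor T x ν := by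
  obtain ⟨ν, hν⟩ := exists_isGenericFor_of_tendsto T hgen h
  refine ⟨ν, (hν.measurePreserving T).ergodic_of_ergodicAverage T fun f ε hε => ?_, hν⟩
  -- The order matters: `p` comes first, then `k` and `c` from the ergodicity of `μ p`. The total is
  -- `ε / 2 + 2 * (ε / 4)`.
  obtain ⟨p, hp⟩ := (besicovitchDist_eventually_avg_le T h f (show 0 < ε / 4 by positivity)).exists
  obtain ⟨k, hk, c, hc⟩ :=
    (herg p).exists_integral_ergodicAverage_sub_const_le T f (half_pos hε)
  refine ⟨k, hk, c, ?_⟩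
  have := hν.integral_abs_ergodicAverage_sub_le T (hgen p) f (by positivity) hp k c
  linarith

end TopDyn

/-- Stated over an arbitrary pseudometric so that `besicovitchPseudoMetric T` can be passed
explicitly beside the original metric. -/
theorem isClosed_of_forall_tendsto_dist {Y : Type*} [PseudoMetricSpace Y] {s : Set Y}
    (h : ∀ (xs : ℕ → Y) (x : Y), (∀ n, xs n ∈ s) →
      Tendsto (fun n => dist (xs n) x) atTop (𝓝 0) → x ∈ s) : IsClosed s := by
  refine IsSeqClosed.isClosed fun xs x hxs hx => h xs x hxs ?_
  exact tendsto_iff_dist_tendsto_zero.1 hx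

theorem mainTheorem2 {X : Type*} [MetricSpace X] [CompactSpace X] [MeasurableSpace X]
    [BorelSpace X] (T : X → X) (hT : Continuous T) :
    (∀ (μ : ℕ → ProbabilityMeasure X) (xs : ℕ → X) (x : X),
      (∀ p, Ergodic T (μ p : Measure X)) →
      (∀ p, TopDyn.IsGenericFor T (xs p) (μ p)) →
      Tendsto (fun p => TopDyn.besicovitchDist T (xs p) x) atTop (𝓝 0) →
      ∃ ν : ProbabilityMeasure X, Ergodic T (ν : Measure X) ∧ TopDyn.IsGenericFor T x ν) ∧
    IsClosed[TopDyn.besicovitchTopology T] (TopDyn.ergodicGenericPoints T) := by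
  have main : ∀ (μ : ℕ → ProbabilityMeasure X) (xs : ℕ → X) (x : X),
      (∀ p, Ergodic T (μ p : Measure X)) →
      (∀ p, TopDyn.IsGenericFor T (xs p) (μ p)) →
      Tendsto (fun p => TopDyn.besicovitchDist T (xs p) x) atTop (𝓝 0) →
      ∃ ν : ProbabilityMeasure X, Ergodic T (ν : Measure X) ∧ TopDyn.IsGenericFor T x ν :=
    fun μ xs x herg hgen h =>
      TopDyn.exists_ergodic_isGenericFor_of_tendsto (⟨T, hT⟩ : C(X, X)) herg hgen h
  refine ⟨main, ?_⟩
  refine @isClosed_of_forall_tendsto_dist X (TopDyn.besicovitchPseudoMetric T) _ ?_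
  intro xs x hxs hx
  choose μ hμ using hxs
  exact main μ xs x (fun p => (hμ p).1) (fun p => (hμ p).2) hx
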